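/- Let $\nu\ge 1$ be an integer, write $\langle x\rangle=(1+|x|^2)^{1/2}$ and $D_x=-\mathrm i\nabla_x$ on $\mathbb R^\nu$. A function $f$ is called rotation invariant if for every $O\in O(\nu)$ one has $f(Ox)=f(x)$ for almost every $x$. Let $s_\Omega\in[0,2]$ and assume the following. (a) $\Omega:\mathbb R^\nu\to[0,\infty)$ is smooth, real-analytic and rotation invariant; there is $C>0$ with $\Omega(\eta)\ge C^{-1}\langle\eta\rangle^{s_\Omega}-C$ for all $\eta$; and for every multi-index $\alpha$ there is $C_\alpha>0$ with $|\partial^\alpha\Omega(\eta)|\le C_\alpha\langle\eta\rangle^{s_\Omega-|\alpha|}$ for all $\eta$. (b) $\omega:\mathbb R^\nu\to[0,\infty)$ is smooth, real-analytic and rotation invariant; $\sup_k|\partial^\alpha\omega(k)|<\infty$ for every multi-index $\alpha$ with $|\alpha|\ge1$; and if $s_\Omega=0$, then $\omega(k)\to\infty$ as $|k|\to\infty$. (c) $\rho\in L^2(\mathbb R^\nu)$ is rotation invariant, $\hat\rho\in C^2(\mathbb R^\nu)$, $\langle\cdot\rangle|\nabla\hat\rho|$ and $\langle\cdot\rangle\|\nabla^2\hat\rho\|$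 belong to $L^2(\mathbb R^\nu)$, and there are $C,\mu>0$ with $|\rho(x)|\le C\langle x\rangle^{-1-\nu/2-\mu}$ for almost every $x$. For $P\in\mathbb R^\nu$ let $H(P)$ be the fiber Hamiltonian on $\mathbb C\oplus L^2(\mathbb R^\nu)$, $$H(P)\begin{pmatrix}u_0\\u_1\end{pmatrix}=\begin{pmatrix}\Omega(P)u_0+\langle\rho,u_1\rangle\\ u_0\,\rho+\bigl(\Omega(P-D_x)+\omega(D_x)\bigr)u_1\end{pmatrix},$$ with domain $\mathbb C\oplus\mathcal D(\Omega(P-D_x)+\omega(D_x))$, where $\Omega(P-D_x)+\omega(D_x)$ is the Fourier multiplier with symbol $k\mapsto\Omega(P-k)+\omega(k)$ on its maximal domain. Put $$\Sigma_{\mathrm{ess}}(P)=\inf_{k\in\mathbb R^\nu}\{\Omega(P-k)+\omega(k)\}.$$ The essential spectrum $\sigma_{\mathrm{ess}}$ is the spectrum with all isolated eigenvalues of finite multiplicity removed. Then, for every $P\in\mathbb R^\nu$: 1. every point of the spectrum of $H(P)$ in $(-\infty,\Sigma_{\mathrm{ess}}(P))$ is an eigenvalue of finite multiplicity; 2. the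 spectrum of $H(P)$ in $(-\infty,\Sigma_{\mathrm{ess}}(P))$ can accumulate only at $\Sigma_{\mathrm{ess}}(P)$; that is, no real number other than $\Sigma_{\mathrm{ess}}(P)$ is an accumulation point of it, and for every $E<\Sigma_{\mathrm{ess}}(P)$ the spectrum of $H(P)$ in $(-\infty,E]$ is finite; 3. $\sigma_{\mathrm{ess}}(H(P))=[\Sigma_{\mathrm{ess}}(P),\infty)$. -/

import Mathlib

open MeasureTheory Filter Topology FourierTransform

noncomputable section

namespace NelsonFiber

/-! ### Spectral notions for unbounded operators on a Hilbert space -/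

section Spectral

variable {K : Type*} [NormedAddCommGroup K] [InnerProductSpace ℂ K]

/-- The resolvent set of an unbounded operator `T`: all `z` such that `T - z` is a bijection from
the domain of `T` onto the whole space with an everywhere defined bounded inverse `R`. -/
def resolventSet (T : K →ₗ.[ℂ] K) : Set ℂ :=
  {z | ∃ R : K →L[ℂ] K,
    (∀ y : K, ∃ h : R y ∈ T.domain, T ⟨R y, h⟩ - z • R y = y) ∧
    (∀ x : T.domain, R (T x - z • (x : K)) = x)}

/-- The spectrum of an unbounded operator. -/
def spectrum (T : K →ₗ.[ℂ] K) : Set ℂ := (resolventSet T)ᶜ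

/-- The eigenspace `ker (T - z)`, as a subspace of the Hilbert space. -/
def eigenspace (T : K →ₗ.[ℂ] K) (z : ℂ) : Submodule ℂ K :=
  (LinearMap.ker (T.toFun - z • T.domain.subtype)).map T.domain.subtype

/-- `z` is an eigenvalue of `T` of finite multiplicity. -/
def IsFiniteMultiplicityEigenvalue (T : K →ₗ.[ℂ] K) (z : ℂ) : Prop :=
  eigenspace T z ≠ ⊥ ∧ FiniteDimensional ℂ (eigenspace T z)

/-- The discrete spectrum of a self-adjoint operator: the isolated points of the spectrum which
are eigenvalues of finite multiplicity. -/
def discreteSpectrum (T : K →ₗ.[ℂ] K) : Set ℂ :=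
  {z | z ∈ spectrum T ∧ ¬ AccPt z (𝓟 (spectrum T)) ∧ IsFiniteMultiplicityEigenvalue T z}

/-- The essential spectrum of a self-adjoint operator: the complement of the discrete spectrum in
the spectrum. -/
def essentialSpectrum (T : K →ₗ.[ℂ] K) : Set ℂ := spectrum T \ discreteSpectrum T

end Spectral

/-! ### The model -/

/-- Configuration space and momentum space `ℝ^ν`. -/
abbrev Space (ν : ℕ) : Type := EuclideanSpace ℝ (Fin ν)

/-- The one-particle space `L²(ℝ^ν)` of complex valued functions. -/
abbrev L2 (ν : ℕ) : Type := Lp ℂ 2 (volume : Measure (Space ν))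

/-- The Hilbert space `ℂ ⊕ L²(ℝ^ν)`. -/
abbrev FiberSpace (ν : ℕ) : Type := WithLp 2 (ℂ × L2 ν)

/-- The bracket `⟨x⟩ = (1 + |x|²)^(1/2)`. -/
def bracket {ν : ℕ} (x : Space ν) : ℝ := Real.sqrt (1 + ‖x‖ ^ 2)

/-- Invariance, almost everywhere, under the orthogonal group `O(ν)`. -/
def RotationInvariant {ν : ℕ} {α : Type*} (f : Space ν → α) : Prop :=
  ∀ O : Space ν ≃ₗᵢ[ℝ] Space ν, ∀ᵐ x : Space ν, f (O x) = f x

/-- The assumptions on the matter dispersion relation, with growth exponent `s`. The bounds on all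
partial derivatives of order `n` are expressed by the norm of the `n`-th derivative. -/
structure MatterDispersion {ν : ℕ} (s : ℝ) (Ω : Space ν → ℝ) : Prop where
  exponent_mem : s ∈ Set.Icc (0 : ℝ) 2
  smooth : ContDiff ℝ (⊤ : ℕ∞) Ω
  analytic : AnalyticOnNhd ℝ Ω Set.univ
  nonneg : ∀ η, 0 ≤ Ω η
  rotationInvariant : RotationInvariant Ω
  lower_bound : ∃ C : ℝ, 0 < C ∧ ∀ η, C⁻¹ * bracket η ^ s - C ≤ Ω η
  deriv_bound : ∀ n : ℕ, ∃ C : ℝ, 0 < C ∧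
    ∀ η, ‖iteratedFDeriv ℝ n Ω η‖ ≤ C * bracket η ^ (s - (n : ℝ))

/-- The assumptions on the field dispersion relation, where `s` is the growth exponent of the
matter dispersion relation. -/
structure FieldDispersion {ν : ℕ} (s : ℝ) (ω : Space ν → ℝ) : Prop where
  smooth : ContDiff ℝ (⊤ : ℕ∞) ω
  analytic : AnalyticOnNhd ℝ ω Set.univ
  nonneg : ∀ k, 0 ≤ ω k
  rotationInvariant : RotationInvariant ω
  deriv_bound : ∀ n : ℕ, 1 ≤ n → ∃ C : ℝ, ∀ k, ‖iteratedFDeriv ℝ n ω k‖ ≤ C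
  tendsto_of_exponent_zero : s = 0 → Tendsto ω (cocompact (Space ν)) atTop

/-- The assumptions on the coupling function `ρ ∈ L²(ℝ^ν)`. The function `g` is the `C²`
representative of the Fourier transform of `ρ`; the conditions on it do not depend on the
normalization of the Fourier transform. -/
structure CouplingFunction {ν : ℕ} (ρ : L2 ν) : Prop where
  rotationInvariant : RotationInvariant (ρ : Space ν → ℂ)
  fourier_regular : ∃ g : Space ν → ℂ,
    ((𝓕 ρ : L2 ν) : Space ν → ℂ) =ᵐ[volume] g ∧ ContDiff ℝ 2 g ∧
    MemLp (fun k => bracket k * ‖fderiv ℝ g k‖) 2 volume ∧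
    MemLp (fun k => bracket k * ‖iteratedFDeriv ℝ 2 g k‖) 2 volume
  short_range : ∃ C μ : ℝ, 0 < C ∧ 0 < μ ∧
    ∀ᵐ x : Space ν, ‖ρ x‖ ≤ C * bracket x ^ (-1 - (ν : ℝ) / 2 - μ)

/-- The symbol of `m(D_x)`, `D_x = -i∇`, applied to `u` on the Fourier side. As the Fourier
transform here is `𝓕 u ξ = ∫ exp (-2πi x·ξ) u x dx`, the operator `D_x` becomes multiplication
by `2πξ`. -/
def symbolMul {ν : ℕ} (m : Space ν → ℝ) (u : L2 ν) : Space ν → ℂ :=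
  fun ξ => (m ((2 * Real.pi) • ξ) : ℂ) * (𝓕 u : L2 ν) ξ

lemma symbolMul_add {ν : ℕ} (m : Space ν → ℝ) (u v : L2 ν) :
    symbolMul m (u + v) =ᵐ[volume] symbolMul m u + symbolMul m v := by
  have h : (𝓕 (u + v) : L2 ν) = 𝓕 u + 𝓕 v :=
    (Lp.fourierTransformₗᵢ (Space ν) ℂ).map_add u v
  filter_upwards [Lp.coeFn_add (𝓕 u : L2 ν) (𝓕 v)] with ξ hξ
  simp only [symbolMul, h, hξ, Pi.add_apply, mul_add]

lemma symbolMul_smul {ν : ℕ} (m : Space ν → ℝ) (c : ℂ) (u : L2 ν) :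
    symbolMul m (c • u) =ᵐ[volume] c • symbolMul m u := by
  have h : (𝓕 (c • u) : L2 ν) = c • 𝓕 u :=
    (Lp.fourierTransformₗᵢ (Space ν) ℂ).map_smul c u
  filter_upwards [Lp.coeFn_smul c (𝓕 u : L2 ν)] with ξ hξ
  simp only [symbolMul, h, hξ, Pi.smul_apply, smul_eq_mul]
  ring

/-- The Fourier multiplier `m(D_x)` on its maximal domain
`{u ∈ L² : m û ∈ L²}`. -/
def multiplier {ν : ℕ} (m : Space ν → ℝ) : L2 ν →ₗ.[ℂ] L2 ν where
  domain :=
    { carrier := {u | MemLp (symbolMul m u) 2 volume}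
      zero_mem' := by
        have h := symbolMul_smul m 0 (0 : L2 ν)
        rw [zero_smul, zero_smul] at h
        exact (memLp_congr_ae h).2 MemLp.zero
      add_mem' := fun {u v} hu hv =>
        (memLp_congr_ae (symbolMul_add m u v)).2 (MemLp.add hu hv)
      smul_mem' := fun c u hu =>
        (memLp_congr_ae (symbolMul_smul m c u)).2 (MemLp.const_smul hu c) }
  toFun :=
    { toFun := fun u => 𝓕⁻ (MemLp.toLp (symbolMul m (u : L2 ν)) u.2 : L2 ν)
      map_add' := fun u v => by
        refine Eq.trans (congrArg (fun f : L2 ν => (𝓕⁻ f : L2 ν)) ?_)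
          ((Lp.fourierTransformₗᵢ (Space ν) ℂ).symm.map_add _ _)
        rw [← MemLp.toLp_add]
        exact MemLp.toLp_congr _ _ (symbolMul_add m u v)
      map_smul' := fun c u => by
        refine Eq.trans (congrArg (fun f : L2 ν => (𝓕⁻ f : L2 ν)) ?_)
          ((Lp.fourierTransformₗᵢ (Space ν) ℂ).symm.map_smul c _)
        rw [← MemLp.toLp_const_smul]
        exact MemLp.toLp_congr _ _ (symbolMul_smul m c u) }

/-- The function `F_P(k) = Ω(P - k) + ω(k)`. -/
def freeSymbol {ν : ℕ} (Ω ω : Space ν → ℝ) (P : Space ν) : Space ν → ℝ :=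
  fun k => Ω (P - k) + ω k

/-- The fiber Hamiltonian at total momentum `P`,
`H(P) (u₀, u₁) = (Ω(P) u₀ + ⟨ρ, u₁⟩, u₀ ρ + (Ω(P - D_x) + ω(D_x)) u₁)`,
on the domain of all `(u₀, u₁)` with `u₁` in the domain of `Ω(P - D_x) + ω(D_x)`. -/
def fiberHamiltonian {ν : ℕ} (Ω ω : Space ν → ℝ) (ρ : L2 ν) (P : Space ν) :
    FiberSpace ν →ₗ.[ℂ] FiberSpace ν where
  domain := (multiplier (freeSymbol Ω ω P)).domain.comap (WithLp.sndₗ 2 ℂ ℂ (L2 ν))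
  toFun :=
    { toFun := fun u => WithLp.toLp 2
        ((Ω P : ℂ) * (u : FiberSpace ν).fst + inner ℂ ρ (u : FiberSpace ν).snd,
          (u : FiberSpace ν).fst • ρ +
            multiplier (freeSymbol Ω ω P) ⟨(u : FiberSpace ν).snd, u.2⟩)
      map_add' := fun u v => by
        have h : multiplier (freeSymbol Ω ω P)
              ⟨((u + v : _) : FiberSpace ν).snd, (u + v).2⟩ =
            multiplier (freeSymbol Ω ω P) ⟨(u : FiberSpace ν).snd, u.2⟩ +
              multiplier (freeSymbol Ω ω P) ⟨(v : FiberSpace ν).snd, v.2⟩ :=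
          (multiplier (freeSymbol Ω ω P)).map_add ⟨_, u.2⟩ ⟨_, v.2⟩
        rw [h, ← WithLp.toLp_add, Prod.mk_add_mk]
        congr 2
        · simp only [Submodule.coe_add, WithLp.add_fst, WithLp.add_snd, inner_add_right]
          ring
        · simp only [Submodule.coe_add, WithLp.add_fst, add_smul]
          abel
      map_smul' := fun c u => by
        have h : multiplier (freeSymbol Ω ω P)
              ⟨((c • u : _) : FiberSpace ν).snd, (c • u).2⟩ =
            c • multiplier (freeSymbol Ω ω P) ⟨(u : FiberSpace ν).snd, u.2⟩ :=
          (multiplier (freeSymbol Ω ω P)).map_smul c ⟨_, u.2⟩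
        rw [h, RingHom.id_apply, ← WithLp.toLp_smul, Prod.smul_mk]
        congr 2
        · simp only [Submodule.coe_smul, WithLp.smul_fst, WithLp.smul_snd, inner_smul_right,
            smul_eq_mul]
          ring
        · simp only [Submodule.coe_smul, WithLp.smul_fst, smul_add, smul_smul, smul_eq_mul] }

/-- `Σ_ess(P) = inf_k (Ω(P - k) + ω(k))`. -/
def essentialThreshold {ν : ℕ} (Ω ω : Space ν → ℝ) (P : Space ν) : ℝ :=
  ⨅ k : Space ν, (Ω (P - k) + ω k)

end NelsonFiber

end

/-!
After a Fourier transform, `H(P)` is the operator of multiplication by `F_P` on `L²`, coupled to a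
one-dimensional space by the vector `ρ̂`. Write `A = F_P(D_x)`. The function `F_P` is continuous and
tends to infinity at infinity, so its range is `[Σ_ess(P), ∞)` (`range_freeSymbol`), and every `z`
outside this half-line is in the resolvent set of `A` (`mem_resolventSet_multiplier`).

For such `z` the Schur complement `S(z) = Ω(P) - z - ⟨ρ, (A - z)⁻¹ ρ⟩` decides everything: if
`S(z) ≠ 0`, block elimination gives a bounded inverse of `H(P) - z` (`exists_schur_eq_zero`); if
`S(z) = 0`, then `z` is an eigenvalue whose eigenspace is a line
(`isFiniteMultiplicityEigenvalue_of_mem_spectrum`). As `A` is symmetric, zeros of `S` are real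
(`im_eq_zero_of_schur_eq_zero`), and as `S` is strictly decreasing below `Σ_ess(P)`, there is at
most one of them (`eq_of_schur_eq_zero`). Hence the spectrum below `Σ_ess(P)` has at most one point,
which is isolated and of multiplicity one.

Conversely, the set where `F_P` is close to a value `F_P(k)` is open and nonempty, and among the
functions whose Fourier transform is supported there some nonzero `u` is orthogonal to `ρ`. The
vectors `(0, u)` do not see the coupling and are approximate eigenvectors of `H(P)`, so that
`[Σ_ess(P), ∞)` lies in the spectrum (`freeSymbol_mem_spectrum`). No point of this half-line is
isolated, which identifies it with the essential spectrum.
-/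

namespace NelsonFiber

/-! ### Fourier multipliers -/

section Multiplier

variable {ν : ℕ} {m : Space ν → ℝ}

lemma fourier_multiplier (u : (multiplier m).domain) :
    ((𝓕 (multiplier m u) : L2 ν) : Space ν → ℂ) =ᵐ[volume] symbolMul m (u : L2 ν) := by
  have h : (𝓕 (multiplier m u) : L2 ν) = MemLp.toLp (symbolMul m (u : L2 ν)) u.2 :=
    (Lp.fourierTransformₗᵢ (Space ν) ℂ).apply_symm_apply _
  rw [h]
  exact MemLp.coeFn_toLp _

lemma fourier_multiplier_sub_smul (z : ℂ) (u : (multiplier m).domain) :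
    ((𝓕 (multiplier m u - z • (u : L2 ν)) : L2 ν) : Space ν → ℂ) =ᵐ[volume]
      fun ξ => ((m ((2 * Real.pi) • ξ) : ℂ) - z) * (𝓕 (u : L2 ν) : L2 ν) ξ := by
  have h : (𝓕 (multiplier m u - z • (u : L2 ν)) : L2 ν) =
      𝓕 (multiplier m u) - z • 𝓕 (u : L2 ν) := by
    have h₁ := (Lp.fourierTransformₗᵢ (Space ν) ℂ).map_sub (multiplier m u) (z • (u : L2 ν))
    rw [(Lp.fourierTransformₗᵢ (Space ν) ℂ).map_smul] at h₁
    exact h₁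
  rw [h]
  filter_upwards [Lp.coeFn_sub (𝓕 (multiplier m u) : L2 ν) (z • 𝓕 (u : L2 ν)),
    Lp.coeFn_smul z (𝓕 (u : L2 ν) : L2 ν), fourier_multiplier u] with ξ h₁ h₂ h₃
  simp only [h₁, h₂, h₃, Pi.sub_apply, Pi.smul_apply, symbolMul, smul_eq_mul]
  ring

lemma eq_of_fourier_ae_eq {u v : L2 ν}
    (h : ((𝓕 u : L2 ν) : Space ν → ℂ) =ᵐ[volume] (𝓕 v : L2 ν)) : u = v :=
  (Lp.fourierTransformₗᵢ (Space ν) ℂ).injective (Lp.ext h)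

/-- Multiplication by a bounded measurable function is a bounded operator on `L²`. -/
lemma exists_clm_ae_eq_mul (φ : Space ν → ℂ) (hφ : Measurable φ) (C : ℝ) (hC : ∀ ξ, ‖φ ξ‖ ≤ C) :
    ∃ M : L2 ν →L[ℂ] L2 ν, ∀ f, (M f : Space ν → ℂ) =ᵐ[volume] fun ξ => φ ξ * f ξ := by
  have bound (f : L2 ν) : ∀ᵐ ξ : Space ν, ‖φ ξ * f ξ‖ ≤ C * ‖f ξ‖ :=
    .of_forall fun ξ => by
      rw [norm_mul]
      exact mul_le_mul_of_nonneg_right (hC ξ) (norm_nonneg _)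
  have mem (f : L2 ν) : MemLp (fun ξ => φ ξ * f ξ) 2 volume :=
    (Lp.memLp f).of_le_mul (hφ.aestronglyMeasurable.mul (Lp.aestronglyMeasurable f)) (bound f)
  let M : L2 ν →ₗ[ℂ] L2 ν :=
    { toFun := fun f => (mem f).toLp
      map_add' := fun f g => by
        rw [← MemLp.toLp_add]
        refine MemLp.toLp_congr _ _ ?_
        filter_upwards [Lp.coeFn_add f g] with ξ h
        simp only [h, Pi.add_apply, mul_add]
      map_smul' := fun c f => by
        rw [RingHom.id_apply, ← MemLp.toLp_const_smul]
        refine MemLp.toLp_congr _ _ ?_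
        filter_upwards [Lp.coeFn_smul c f] with ξ h
        simp only [h, Pi.smul_apply, smul_eq_mul]
        ring }
  refine ⟨M.mkContinuous C fun f => ?_, fun f => (mem f).coeFn_toLp⟩
  refine Lp.norm_le_mul_norm_of_ae_le_mul ?_
  filter_upwards [(mem f).coeFn_toLp, bound f] with ξ h₁ h₂
  change ‖((mem f).toLp : Space ν → ℂ) ξ‖ ≤ _
  rwa [h₁]

lemma exists_clm_fourier_ae_eq_mul (φ : Space ν → ℂ) (hφ : Measurable φ) (C : ℝ)
    (hC : ∀ ξ, ‖φ ξ‖ ≤ C) : ∃ R : L2 ν →L[ℂ] L2 ν,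
      ∀ f, ((𝓕 (R f) : L2 ν) : Space ν → ℂ) =ᵐ[volume] fun ξ => φ ξ * (𝓕 f : L2 ν) ξ := by
  obtain ⟨M, hM⟩ := exists_clm_ae_eq_mul φ hφ C hC
  let F := (Lp.fourierTransformₗᵢ (Space ν) ℂ).toContinuousLinearEquiv
  refine ⟨(F.symm : L2 ν →L[ℂ] L2 ν) ∘L M ∘L (F : L2 ν →L[ℂ] L2 ν), fun f => ?_⟩
  have h : (𝓕 (F.symm (M (𝓕 f))) : L2 ν) = M (𝓕 f) :=
    (Lp.fourierTransformₗᵢ (Space ν) ℂ).apply_symm_apply _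
  change ((𝓕 (F.symm (M (𝓕 f))) : L2 ν) : Space ν → ℂ) =ᵐ[volume] _
  rw [h]
  exact hM _

lemma mem_resolventSet_multiplier (hm : Continuous m) {z : ℂ} {δ : ℝ} (hδ : 0 < δ)
    (h : ∀ k, δ ≤ ‖(m k : ℂ) - z‖) : z ∈ resolventSet (multiplier m) := by
  have hne (k : Space ν) : (m k : ℂ) - z ≠ 0 := norm_pos_iff.1 (hδ.trans_le (h k))
  have hm' : Measurable fun ξ : Space ν => (m ((2 * Real.pi) • ξ) : ℂ) :=
    (Complex.continuous_ofReal.comp (hm.comp (continuous_const_smul _))).measurable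
  have hC (ξ : Space ν) : ‖((m ((2 * Real.pi) • ξ) : ℂ) - z)⁻¹‖ ≤ δ⁻¹ := by
    rw [norm_inv]
    exact inv_anti₀ hδ (h _)
  obtain ⟨R, hR⟩ := exists_clm_fourier_ae_eq_mul
    (fun ξ => ((m ((2 * Real.pi) • ξ) : ℂ) - z)⁻¹) (hm'.sub_const z).inv δ⁻¹ hC
  refine ⟨R, fun y => ?_, fun x => ?_⟩
  · have hdom : R y ∈ (multiplier m).domain := by
      -- `m û = ŷ + z û` with `u = (m - z)⁻¹ y` is square integrable
      refine (memLp_congr_ae ?_).1 (Lp.memLp ((𝓕 y : L2 ν) + z • (𝓕 (R y) : L2 ν)))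
      filter_upwards [hR y, Lp.coeFn_add (𝓕 y : L2 ν) (z • (𝓕 (R y) : L2 ν)),
        Lp.coeFn_smul z (𝓕 (R y) : L2 ν)] with ξ h₂ h₃ h₄
      have := hne ((2 * Real.pi) • ξ)
      simp only [symbolMul, h₃, h₄, Pi.add_apply, Pi.smul_apply, h₂, smul_eq_mul]
      field_simp
      ring
    refine ⟨hdom, eq_of_fourier_ae_eq ?_⟩
    filter_upwards [fourier_multiplier_sub_smul z ⟨R y, hdom⟩, hR y] with ξ h₁ h₂
    rw [h₁, h₂, mul_inv_cancel_left₀ (hne _)]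
  · refine eq_of_fourier_ae_eq ?_
    filter_upwards [fourier_multiplier_sub_smul z x, hR (multiplier m x - z • (x : L2 ν))]
      with ξ h₁ h₂
    rw [h₂, h₁, inv_mul_cancel_left₀ (hne _)]

lemma inner_eq_integral_fourier (u v : L2 ν) :
    inner ℂ u v = ∫ ξ, inner ℂ ((𝓕 u : L2 ν) ξ) ((𝓕 v : L2 ν) ξ) := by
  rw [← Lp.inner_fourier_eq, L2.inner_def]

/-- Fourier multipliers with real symbols are symmetric. -/
lemma inner_multiplier_left (u v : (multiplier m).domain) :
    inner ℂ (multiplier m u) (v : L2 ν) = inner ℂ (u : L2 ν) (multiplier m v) := by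
  rw [inner_eq_integral_fourier, inner_eq_integral_fourier]
  refine integral_congr_ae ?_
  filter_upwards [fourier_multiplier u, fourier_multiplier v] with ξ h₁ h₂
  rw [h₁, h₂]
  simp only [symbolMul, RCLike.inner_apply, map_mul, Complex.conj_ofReal]
  ring

/-- If `(m - E₁) û = (m - E₂) v̂` and `m > E₁, E₂`, then `û` and `v̂` are positive multiples of
each other at almost every point. -/
lemma re_inner_nonneg_of_multiplier_sub_eq {E₁ E₂ : ℝ} (h₁ : ∀ k, E₁ < m k)
    (h₂ : ∀ k, E₂ < m k) (u v : (multiplier m).domain)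
    (huv : multiplier m u - (E₁ : ℂ) • (u : L2 ν) = multiplier m v - (E₂ : ℂ) • (v : L2 ν)) :
    0 ≤ (inner ℂ (u : L2 ν) (v : L2 ν)).re := by
  rw [inner_eq_integral_fourier]
  have key := fourier_multiplier_sub_smul (E₁ : ℂ) u
  rw [huv] at key
  have hint : Integrable (fun ξ => inner ℂ ((𝓕 (u : L2 ν) : L2 ν) ξ) ((𝓕 (v : L2 ν) : L2 ν) ξ))
      (volume : Measure (Space ν)) := L2.integrable_inner _ _
  have := integral_re hint
  simp only [RCLike.re_to_complex] at this
  rw [← this]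
  refine integral_nonneg_of_ae ?_
  filter_upwards [key, fourier_multiplier_sub_smul (E₂ : ℂ) v] with ξ h₃ h₄
  rw [h₃] at h₄
  have p₁ := sub_pos.2 (h₁ ((2 * Real.pi) • ξ))
  have p₂ := sub_pos.2 (h₂ ((2 * Real.pi) • ξ))
  set a := m ((2 * Real.pi) • ξ) - E₁ with ha
  set b := m ((2 * Real.pi) • ξ) - E₂ with hb
  set x := (𝓕 (u : L2 ν) : L2 ν) ξ
  set y := (𝓕 (v : L2 ν) : L2 ν) ξ
  have hxy : x = ((b / a : ℝ) : ℂ) * y := by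
    have ha' : (a : ℂ) ≠ 0 := by exact_mod_cast p₁.ne'
    have h₅ : (a : ℂ) * x = b * y := by
      rw [ha, hb]
      push_cast
      exact h₄
    push_cast
    field_simp
    linear_combination h₅
  have hre : (inner ℂ x y).re = b / a * ‖y‖ ^ 2 := by
    rw [hxy, ← smul_eq_mul, inner_smul_left, inner_self_eq_norm_sq_to_K, Complex.conj_ofReal,
      Complex.re_ofReal_mul]
    norm_cast
  simp only [Pi.zero_apply]
  rw [hre]
  positivity

end Multiplier

/-! ### The Schur complement -/

section Schur

variable {ν : ℕ} {Ω ω : Space ν → ℝ} {ρ : L2 ν} {P : Space ν}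

lemma fiberHamiltonian_ext_iff (z : ℂ) (x : (fiberHamiltonian Ω ω ρ P).domain)
    (y : FiberSpace ν) :
    fiberHamiltonian Ω ω ρ P x - z • (x : FiberSpace ν) = y ↔
      ((Ω P : ℂ) - z) * (x : FiberSpace ν).fst + inner ℂ ρ (x : FiberSpace ν).snd = y.fst ∧
      (x : FiberSpace ν).fst • ρ + (multiplier (freeSymbol Ω ω P) ⟨(x : FiberSpace ν).snd, x.2⟩
        - z • (x : FiberSpace ν).snd) = y.snd := by
  have h₁ : (fiberHamiltonian Ω ω ρ P x - z • (x : FiberSpace ν)).fst =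
      ((Ω P : ℂ) - z) * (x : FiberSpace ν).fst + inner ℂ ρ (x : FiberSpace ν).snd := by
    change (Ω P : ℂ) * (x : FiberSpace ν).fst + inner ℂ ρ (x : FiberSpace ν).snd -
      z * (x : FiberSpace ν).fst = _
    ring
  have h₂ : (fiberHamiltonian Ω ω ρ P x - z • (x : FiberSpace ν)).snd =
      (x : FiberSpace ν).fst • ρ + (multiplier (freeSymbol Ω ω P) ⟨(x : FiberSpace ν).snd, x.2⟩
        - z • (x : FiberSpace ν).snd) := by
    change (x : FiberSpace ν).fst • ρ + multiplier (freeSymbol Ω ω P) ⟨(x : FiberSpace ν).snd, x.2⟩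
        - z • (x : FiberSpace ν).snd = _
    abel
  rw [← h₁, ← h₂]
  constructor
  · rintro rfl
    exact ⟨rfl, rfl⟩
  · rintro ⟨h₃, h₄⟩
    exact (WithLp.ofLp_injective 2) (Prod.ext h₃ h₄)

lemma mem_eigenspace_iff {K : Type*} [NormedAddCommGroup K] [InnerProductSpace ℂ K]
    (T : K →ₗ.[ℂ] K) (z : ℂ) (x : K) :
    x ∈ eigenspace T z ↔ ∃ h : x ∈ T.domain, T ⟨x, h⟩ - z • x = 0 := by
  simp only [eigenspace, Submodule.mem_map, LinearMap.mem_ker]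
  constructor
  · rintro ⟨y, hy, rfl⟩
    exact ⟨y.2, hy⟩
  · rintro ⟨h, hx⟩
    exact ⟨⟨x, h⟩, hx, rfl⟩

/-- The Feshbach-Schur principle: if `z` is in the resolvent set of `A = F_P(D_x)` and in the
spectrum of `H(P)`, then the Schur complement `Ω(P) - z - ⟨ρ, (A - z)⁻¹ ρ⟩` vanishes. Here
`v = (A - z)⁻¹ ρ`. -/
lemma exists_schur_eq_zero {z : ℂ} (hz : z ∈ resolventSet (multiplier (freeSymbol Ω ω P)))
    (hs : z ∈ spectrum (fiberHamiltonian Ω ω ρ P)) :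
    ∃ v : (multiplier (freeSymbol Ω ω P)).domain,
      multiplier (freeSymbol Ω ω P) v - z • (v : L2 ν) = ρ ∧
      (Ω P : ℂ) - z = inner ℂ ρ (v : L2 ν) := by
  obtain ⟨R, hR₁, hR₂⟩ := hz
  obtain ⟨hρ, hρ'⟩ := hR₁ ρ
  refine ⟨⟨R ρ, hρ⟩, hρ', ?_⟩
  by_contra hne
  set S : ℂ := (Ω P : ℂ) - z - inner ℂ ρ (R ρ) with hS
  have hS0 : S ≠ 0 := sub_ne_zero.2 hne
  refine hs ?_
  let a : FiberSpace ν →L[ℂ] ℂ := S⁻¹ • (WithLp.fstL 2 ℂ ℂ (L2 ν) -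
    (innerSL ℂ ρ) ∘L R ∘L WithLp.sndL 2 ℂ ℂ (L2 ν))
  have ha (y : FiberSpace ν) : a y = S⁻¹ * (y.fst - inner ℂ ρ (R y.snd)) := rfl
  let Q : FiberSpace ν →L[ℂ] FiberSpace ν :=
    ((WithLp.prodContinuousLinearEquiv 2 ℂ ℂ (L2 ν)).symm : ℂ × L2 ν →L[ℂ] FiberSpace ν) ∘L
      (a.prod (R ∘L WithLp.sndL 2 ℂ ℂ (L2 ν) - a.smulRight (R ρ)))
  have hQ₁ (y : FiberSpace ν) : (Q y).fst = a y := rfl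
  have hQ₂ (y : FiberSpace ν) : (Q y).snd = R y.snd - a y • R ρ := rfl
  have hQR (y : FiberSpace ν) : (Q y).snd = R (y.snd - a y • ρ) := by
    rw [hQ₂, map_sub, map_smul]
  refine ⟨Q, fun y => ?_, fun x => ?_⟩
  · obtain ⟨h₁, h₂⟩ := hR₁ (y.snd - a y • ρ)
    have hdom : Q y ∈ (fiberHamiltonian Ω ω ρ P).domain := by
      change (Q y).snd ∈ (multiplier (freeSymbol Ω ω P)).domain
      rw [hQR]
      exact h₁
    refine ⟨hdom, (fiberHamiltonian_ext_iff z ⟨Q y, hdom⟩ y).2 ⟨?_, ?_⟩⟩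
    · simp only [hQ₁, hQ₂, inner_sub_right, inner_smul_right]
      have : ((Ω P : ℂ) - z - inner ℂ ρ (R ρ)) * a y = y.fst - inner ℂ ρ (R y.snd) := by
        rw [ha, ← hS, mul_inv_cancel_left₀ hS0]
      linear_combination this
    · simp only [hQ₁, hQR]
      rw [h₂]
      abel
  · set w := fiberHamiltonian Ω ω ρ P x - z • (x : FiberSpace ν) with hw
    obtain ⟨h₁, h₂⟩ := (fiberHamiltonian_ext_iff z x w).1 hw.symm
    have h₃ : R w.snd = (x : FiberSpace ν).fst • R ρ + (x : FiberSpace ν).snd := by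
      rw [← h₂, map_add, map_smul, hR₂ ⟨(x : FiberSpace ν).snd, x.2⟩]
    have h₄ : a w = (x : FiberSpace ν).fst := by
      rw [ha, h₃, ← h₁, inner_add_right, inner_smul_right, inv_mul_eq_iff_eq_mul₀ hS0, hS]
      ring
    refine (WithLp.ofLp_injective 2) (Prod.ext h₄ ?_)
    change (Q w).snd = (x : FiberSpace ν).snd
    rw [hQ₂, h₃, h₄]
    abel

/-- Where the Schur complement vanishes, the eigenspace of `H(P)` is the line spanned by
`(1, -(A - z)⁻¹ ρ)`. -/
lemma isFiniteMultiplicityEigenvalue_of_mem_spectrum {z : ℂ}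
    (hz : z ∈ resolventSet (multiplier (freeSymbol Ω ω P)))
    (hs : z ∈ spectrum (fiberHamiltonian Ω ω ρ P)) :
    IsFiniteMultiplicityEigenvalue (fiberHamiltonian Ω ω ρ P) z := by
  obtain ⟨v, hv, hv'⟩ := exists_schur_eq_zero hz hs
  obtain ⟨R, -, hR⟩ := hz
  have hRρ : R ρ = v := by rw [← hv, hR v]
  let e : FiberSpace ν := WithLp.toLp 2 (1, -(v : L2 ν))
  have hdom : e ∈ (fiberHamiltonian Ω ω ρ P).domain :=
    (multiplier (freeSymbol Ω ω P)).domain.neg_mem v.2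
  have he : e ∈ eigenspace (fiberHamiltonian Ω ω ρ P) z := by
    refine (mem_eigenspace_iff _ _ _).2 ⟨hdom, (fiberHamiltonian_ext_iff z ⟨e, hdom⟩ 0).2 ⟨?_, ?_⟩⟩
    · change ((Ω P : ℂ) - z) * 1 + inner ℂ ρ (-(v : L2 ν)) = 0
      rw [hv', inner_neg_right]
      ring
    · change (1 : ℂ) • ρ + (multiplier (freeSymbol Ω ω P) (-v) - z • -(v : L2 ν)) = 0
      rw [(multiplier (freeSymbol Ω ω P)).map_neg, one_smul, smul_neg, ← neg_sub', hv,
        add_neg_cancel]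
  have hle : eigenspace (fiberHamiltonian Ω ω ρ P) z ≤ Submodule.span ℂ {e} := by
    intro x hx
    obtain ⟨hxd, hx0⟩ := (mem_eigenspace_iff _ _ _).1 hx
    obtain ⟨-, h₂⟩ := (fiberHamiltonian_ext_iff z ⟨x, hxd⟩ 0).1 hx0
    have h₃ : x.fst • R ρ + x.snd = 0 := by
      have := congrArg R h₂
      rw [map_add, map_smul, hR ⟨x.snd, hxd⟩] at this
      exact this.trans (map_zero R)
    refine Submodule.mem_span_singleton.2 ⟨x.fst, (WithLp.ofLp_injective 2) (Prod.ext ?_ ?_)⟩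
    · exact mul_one _
    · change x.fst • -(v : L2 ν) = x.snd
      rw [smul_neg, ← hRρ]
      exact neg_eq_of_add_eq_zero_right h₃
  refine ⟨fun h => ?_, Submodule.finiteDimensional_of_le hle⟩
  have h0 : e = 0 := by
    rw [h] at he
    exact (Submodule.mem_bot ℂ).1 he
  exact one_ne_zero (congrArg WithLp.fst h0 : (1 : ℂ) = 0)

lemma im_eq_zero_of_schur_eq_zero {z : ℂ} (v : (multiplier (freeSymbol Ω ω P)).domain)
    (hv : multiplier (freeSymbol Ω ω P) v - z • (v : L2 ν) = ρ)
    (hz : (Ω P : ℂ) - z = inner ℂ ρ (v : L2 ν)) : z.im = 0 := by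
  have h₁ : (inner ℂ (multiplier (freeSymbol Ω ω P) v) (v : L2 ν)).im = 0 := by
    have := inner_conj_symm (𝕜 := ℂ) (multiplier (freeSymbol Ω ω P) v) (v : L2 ν)
    rw [← inner_multiplier_left] at this
    exact Complex.conj_eq_iff_im.1 this
  rw [← hv, inner_sub_left, inner_smul_left, inner_self_eq_norm_sq_to_K] at hz
  have h₂ := congrArg Complex.im hz
  have h₃ : ((starRingEnd ℂ) z * ((‖(v : L2 ν)‖ : ℂ)) ^ 2).im = -z.im * ‖(v : L2 ν)‖ ^ 2 := by
    rw [← Complex.ofReal_pow, Complex.im_mul_ofReal, Complex.conj_im]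
  simp only [Complex.sub_im, Complex.ofReal_im, h₁, Complex.coe_algebraMap, h₃] at h₂
  nlinarith [sq_nonneg ‖(v : L2 ν)‖]

/-- Below the range of the symbol the Schur complement is strictly decreasing, so that it has at
most one zero. -/
lemma eq_of_schur_eq_zero {E₁ E₂ : ℝ} (h₁ : ∀ k, E₁ < freeSymbol Ω ω P k)
    (h₂ : ∀ k, E₂ < freeSymbol Ω ω P k) (v₁ v₂ : (multiplier (freeSymbol Ω ω P)).domain)
    (hv₁ : multiplier (freeSymbol Ω ω P) v₁ - (E₁ : ℂ) • (v₁ : L2 ν) = ρ)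
    (hv₂ : multiplier (freeSymbol Ω ω P) v₂ - (E₂ : ℂ) • (v₂ : L2 ν) = ρ)
    (hE₁ : (Ω P : ℂ) - E₁ = inner ℂ ρ (v₁ : L2 ν))
    (hE₂ : (Ω P : ℂ) - E₂ = inner ℂ ρ (v₂ : L2 ν)) : E₁ = E₂ := by
  have hpos := re_inner_nonneg_of_multiplier_sub_eq h₁ h₂ v₁ v₂ (hv₁.trans hv₂.symm)
  have hsymm := inner_multiplier_left v₁ v₂
  have hc := congrArg (starRingEnd ℂ) hE₁
  rw [inner_conj_symm, map_sub, Complex.conj_ofReal, Complex.conj_ofReal] at hc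
  rw [sub_eq_iff_eq_add.1 hv₁, sub_eq_iff_eq_add.1 hv₂, inner_add_left, inner_add_right,
    inner_smul_left, inner_smul_right, Complex.conj_ofReal, ← hc, ← hE₂] at hsymm
  have key : ((E₁ - E₂ : ℝ) : ℂ) * (1 + inner ℂ (v₁ : L2 ν) (v₂ : L2 ν)) = 0 := by
    push_cast
    linear_combination hsymm
  rcases mul_eq_zero.1 key with h | h
  · exact sub_eq_zero.1 (Complex.ofReal_eq_zero.1 h)
  · have := congrArg Complex.re h
    simp only [Complex.add_re, Complex.one_re, Complex.zero_re] at this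
    linarith

end Schur

/-! ### Approximate eigenvectors -/

section Weyl

variable {ν : ℕ}

lemma exists_ne_zero_ae_eq_zero_off_ball (x : Space ν) {ε : ℝ} (hε : 0 < ε) :
    ∃ g : L2 ν, g ≠ 0 ∧ ∀ᵐ ξ : Space ν, ξ ∉ Metric.ball x ε → g ξ = 0 := by
  have hfin : (volume : Measure (Space ν)) (Metric.ball x ε) ≠ ⊤ := measure_ball_lt_top.ne
  refine ⟨indicatorConstLp 2 measurableSet_ball hfin (1 : ℂ), ?_, indicatorConstLp_coeFn_notMem⟩
  rw [← norm_ne_zero_iff, norm_indicatorConstLp two_ne_zero ENNReal.ofNat_ne_top, norm_one,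
    one_mul]
  have := ENNReal.toReal_pos (Metric.measure_ball_pos volume x hε).ne' hfin
  exact (Real.rpow_pos_of_pos this _).ne'

/-- A nonempty open set carries a nonzero square integrable function orthogonal to a given one:
combine two functions with disjoint supports. -/
lemma exists_ne_zero_inner_eq_zero (hν : 1 ≤ ν) (r : L2 ν) {U : Set (Space ν)} (hU : IsOpen U)
    (hne : U.Nonempty) :
    ∃ f : L2 ν, f ≠ 0 ∧ inner ℂ r f = 0 ∧ ∀ᵐ ξ : Space ν, ξ ∉ U → f ξ = 0 := by
  have : Nonempty (Fin ν) := ⟨⟨0, hν⟩⟩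
  obtain ⟨x, hx⟩ := hne
  obtain ⟨y, hyU, hyx⟩ : ∃ y ∈ U, y ≠ x :=
    ((infinite_of_mem_nhds x (hU.mem_nhds hx)).nontrivial).exists_ne x
  obtain ⟨a, ha, haU⟩ := Metric.isOpen_iff.1 hU x hx
  obtain ⟨b, hb, hbU⟩ := Metric.isOpen_iff.1 hU y hyU
  have hd : 0 < dist x y / 2 := half_pos (dist_pos.2 hyx.symm)
  obtain ⟨g, hg, hgs⟩ := exists_ne_zero_ae_eq_zero_off_ball x (lt_min ha hd)
  obtain ⟨h, hh, hhs⟩ := exists_ne_zero_ae_eq_zero_off_ball y (lt_min hb hd)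
  have hdisj : Disjoint (Metric.ball x (min a (dist x y / 2)))
      (Metric.ball y (min b (dist x y / 2))) :=
    Metric.ball_disjoint_ball (by
      linarith [min_le_right a (dist x y / 2), min_le_right b (dist x y / 2)])
  have hgU : Metric.ball x (min a (dist x y / 2)) ⊆ U :=
    (Metric.ball_subset_ball (min_le_left _ _)).trans haU
  have hhU : Metric.ball y (min b (dist x y / 2)) ⊆ U :=
    (Metric.ball_subset_ball (min_le_left _ _)).trans hbU
  have horth : inner ℂ h g = 0 := by
    rw [L2.inner_def]
    refine integral_eq_zero_of_ae ?_
    filter_upwards [hgs, hhs] with ξ h₁ h₂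
    by_cases hξ : ξ ∈ Metric.ball x (min a (dist x y / 2))
    · rw [h₂ (Set.disjoint_left.1 hdisj hξ), inner_zero_left, Pi.zero_apply]
    · rw [h₁ hξ, inner_zero_right, Pi.zero_apply]
  by_cases hr : inner ℂ r g = 0
  · refine ⟨g, hg, hr, ?_⟩
    filter_upwards [hgs] with ξ h₁ hξ using h₁ fun h => hξ (hgU h)
  · refine ⟨inner ℂ r h • g - inner ℂ r g • h, fun h0 => ?_, ?_, ?_⟩
    · have h₁ : inner ℂ h (inner ℂ r h • g - inner ℂ r g • h) = 0 := by
        rw [h0, inner_zero_right]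
      rw [inner_sub_right, inner_smul_right, inner_smul_right, horth, mul_zero, zero_sub,
        neg_eq_zero] at h₁
      exact (mul_ne_zero hr (inner_self_ne_zero.2 hh)) h₁
    · rw [inner_sub_right, inner_smul_right, inner_smul_right]
      ring
    · filter_upwards [hgs, hhs, Lp.coeFn_sub (inner ℂ r h • g) (inner ℂ r g • h),
        Lp.coeFn_smul (inner ℂ r h) g, Lp.coeFn_smul (inner ℂ r g) h] with ξ h₁ h₂ h₃ h₄ h₅ hξ
      rw [h₃, Pi.sub_apply, h₄, h₅, Pi.smul_apply, Pi.smul_apply, h₁ fun h => hξ (hgU h),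
        h₂ fun h => hξ (hhU h), smul_zero, smul_zero, sub_zero]

/-- Every value of the symbol is an approximate eigenvalue of the multiplier, with approximate
eigenvectors orthogonal to a given vector. -/
lemma exists_approx_eigenvector (hν : 1 ≤ ν) {m : Space ν → ℝ} (hm : Continuous m) (ρ : L2 ν)
    (k : Space ν) {ε : ℝ} (hε : 0 < ε) :
    ∃ u : (multiplier m).domain, (u : L2 ν) ≠ 0 ∧ inner ℂ ρ (u : L2 ν) = 0 ∧
      ‖multiplier m u - (m k : ℂ) • (u : L2 ν)‖ ≤ ε * ‖(u : L2 ν)‖ := by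
  have hc : Continuous fun ξ : Space ν => m ((2 * Real.pi) • ξ) :=
    hm.comp (continuous_const_smul _)
  have hπ : (2 * Real.pi) ≠ 0 := by positivity
  let U : Set (Space ν) := {ξ | |m ((2 * Real.pi) • ξ) - m k| < ε}
  have hU : IsOpen U := isOpen_lt (hc.sub continuous_const).abs continuous_const
  have hne : U.Nonempty := ⟨(2 * Real.pi)⁻¹ • k, by
    change |m ((2 * Real.pi) • (2 * Real.pi)⁻¹ • k) - m k| < ε
    rwa [smul_inv_smul₀ hπ, sub_self, abs_zero]⟩
  obtain ⟨f, hf, hρf, hfs⟩ := exists_ne_zero_inner_eq_zero hν (𝓕 ρ : L2 ν) hU hne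
  obtain ⟨u, rfl⟩ : ∃ u : L2 ν, (𝓕 u : L2 ν) = f :=
    ⟨𝓕⁻ f, (Lp.fourierTransformₗᵢ (Space ν) ℂ).apply_symm_apply f⟩
  have hbound : ∀ᵐ ξ : Space ν, ‖((m ((2 * Real.pi) • ξ) : ℂ) - m k) * (𝓕 u : L2 ν) ξ‖ ≤
      ε * ‖(𝓕 u : L2 ν) ξ‖ := by
    filter_upwards [hfs] with ξ h
    rw [norm_mul]
    by_cases hξ : ξ ∈ U
    · refine mul_le_mul_of_nonneg_right ?_ (norm_nonneg _)
      rw [← Complex.ofReal_sub, Complex.norm_real]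
      exact (show |m ((2 * Real.pi) • ξ) - m k| < ε from hξ).le
    · rw [h hξ, norm_zero, mul_zero, mul_zero]
  have hdom : u ∈ (multiplier m).domain := by
    refine (Lp.memLp (𝓕 u : L2 ν)).of_le_mul (c := ε + |m k|) ?_ ?_
    · exact (Complex.continuous_ofReal.comp hc).aestronglyMeasurable.mul
        (Lp.aestronglyMeasurable _)
    · filter_upwards [hbound] with ξ h
      have h₁ : symbolMul m u ξ = ((m ((2 * Real.pi) • ξ) : ℂ) - m k) * (𝓕 u : L2 ν) ξ +
          (m k : ℂ) * (𝓕 u : L2 ν) ξ := by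
        simp only [symbolMul]
        ring
      rw [h₁, add_mul]
      refine (norm_add_le _ _).trans (add_le_add h ?_)
      rw [norm_mul, Complex.norm_real, Real.norm_eq_abs]
  refine ⟨⟨u, hdom⟩, ?_, ?_, ?_⟩
  · rintro (rfl : u = 0)
    exact hf (Lp.fourierTransformₗᵢ (Space ν) ℂ).map_zero
  · rwa [Lp.inner_fourier_eq] at hρf
  · rw [← Lp.norm_fourier_eq, ← Lp.norm_fourier_eq (E := Space ν) (F := ℂ) u]
    refine Lp.norm_le_mul_norm_of_ae_le_mul ?_
    filter_upwards [hbound, fourier_multiplier_sub_smul (m k : ℂ) ⟨u, hdom⟩] with ξ h₁ h₂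
    rwa [h₂]

/-- The coupling is invisible to vectors `(0, u)` with `u` orthogonal to `ρ`, so that the range of
the symbol lies in the spectrum of `H(P)`. -/
lemma freeSymbol_mem_spectrum (hν : 1 ≤ ν) {Ω ω : Space ν → ℝ} {P : Space ν}
    (hm : Continuous (freeSymbol Ω ω P)) (ρ : L2 ν) (k : Space ν) :
    (freeSymbol Ω ω P k : ℂ) ∈ spectrum (fiberHamiltonian Ω ω ρ P) := by
  rintro ⟨R, -, hR⟩
  have hε : 0 < (‖R‖ + 1)⁻¹ := by positivity
  obtain ⟨u, hu, hρu, hAu⟩ := exists_approx_eigenvector hν hm ρ k hε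
  have hx := (fiberHamiltonian_ext_iff (ρ := ρ) (freeSymbol Ω ω P k : ℂ)
    ⟨WithLp.toLp 2 (0, (u : L2 ν)), u.2⟩ (WithLp.toLp 2 (0, multiplier (freeSymbol Ω ω P) u -
      (freeSymbol Ω ω P k : ℂ) • (u : L2 ν)))).2
    ⟨by simpa using hρu, by simp⟩
  have h₁ := hR ⟨WithLp.toLp 2 (0, (u : L2 ν)), u.2⟩
  rw [hx] at h₁
  have h₂ := R.le_opNorm (WithLp.toLp 2 (0, multiplier (freeSymbol Ω ω P) u -
      (freeSymbol Ω ω P k : ℂ) • (u : L2 ν)))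
  rw [h₁, WithLp.norm_toLp_snd, WithLp.norm_toLp_snd] at h₂
  have hu' : 0 < ‖(u : L2 ν)‖ := norm_pos_iff.2 hu
  have h₃ : ‖(u : L2 ν)‖ ≤ ‖R‖ * ((‖R‖ + 1)⁻¹ * ‖(u : L2 ν)‖) :=
    h₂.trans (mul_le_mul_of_nonneg_left hAu (norm_nonneg _))
  have h₄ : ‖R‖ * (‖R‖ + 1)⁻¹ < 1 := by
    rw [← div_eq_mul_inv, div_lt_one (by positivity)]
    exact lt_add_one _
  nlinarith

end Weyl

/-! ### The range of the symbol -/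

section Range

variable {ν : ℕ} {s : ℝ} {Ω ω : Space ν → ℝ}

lemma continuous_freeSymbol (hΩ : MatterDispersion s Ω) (hω : FieldDispersion s ω)
    (P : Space ν) : Continuous (freeSymbol Ω ω P) :=
  (hΩ.smooth.continuous.comp (continuous_const.sub continuous_id)).add hω.smooth.continuous

lemma tendsto_bracket_cocompact : Tendsto (bracket : Space ν → ℝ) (cocompact _) atTop := by
  refine tendsto_atTop_mono (fun x => ?_) (tendsto_norm_cocompact_atTop (E := Space ν))
  exact Real.le_sqrt_of_sq_le (by linarith)

lemma tendsto_freeSymbol_cocompact (hΩ : MatterDispersion s Ω) (hω : FieldDispersion s ω)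
    (P : Space ν) : Tendsto (freeSymbol Ω ω P) (cocompact _) atTop := by
  rcases hΩ.exponent_mem.1.eq_or_lt with h | h
  · exact tendsto_atTop_mono (fun k => le_add_of_nonneg_left (hΩ.nonneg _))
      (hω.tendsto_of_exponent_zero h.symm)
  · obtain ⟨C, hC, hlow⟩ := hΩ.lower_bound
    have h₁ : Tendsto (fun η => C⁻¹ * bracket η ^ s - C) (cocompact (Space ν)) atTop :=
      tendsto_atTop_add_const_right _ _
        (((tendsto_rpow_atTop h).comp tendsto_bracket_cocompact).const_mul_atTop (inv_pos.2 hC))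
    have h₂ : Tendsto Ω (cocompact (Space ν)) atTop := tendsto_atTop_mono hlow h₁
    exact tendsto_atTop_mono (fun k => le_add_of_nonneg_right (hω.nonneg _))
      (h₂.comp (Homeomorph.subLeft P).isClosedEmbedding.tendsto_cocompact)

lemma essentialThreshold_le (hΩ : MatterDispersion s Ω) (hω : FieldDispersion s ω)
    (P k : Space ν) : essentialThreshold Ω ω P ≤ freeSymbol Ω ω P k :=
  ciInf_le ⟨0, by rintro _ ⟨k, rfl⟩; exact add_nonneg (hΩ.nonneg _) (hω.nonneg _)⟩ k

lemma range_freeSymbol (hν : 1 ≤ ν) (hΩ : MatterDispersion s Ω) (hω : FieldDispersion s ω)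
    (P : Space ν) : Set.range (freeSymbol Ω ω P) = Set.Ici (essentialThreshold Ω ω P) := by
  have : Nonempty (Fin ν) := ⟨⟨0, hν⟩⟩
  have hc := continuous_freeSymbol hΩ hω P
  have ht := tendsto_freeSymbol_cocompact hΩ hω P
  obtain ⟨k₀, hk₀⟩ := hc.exists_forall_le ht
  refine Set.Subset.antisymm ?_ fun E hE => ?_
  · rintro _ ⟨k, rfl⟩
    exact essentialThreshold_le hΩ hω P k
  · obtain ⟨k₁, hk₁⟩ := (ht.eventually_ge_atTop E).exists
    have h₀ : freeSymbol Ω ω P k₀ ≤ E := (le_ciInf hk₀).trans hE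
    exact mem_range_of_exists_le_of_exists_ge hc ⟨k₀, h₀⟩ ⟨k₁, hk₁⟩

end Range

/-! ### The spectrum of the fiber Hamiltonian -/

section FiberSpectrum

variable {ν : ℕ} {s : ℝ} {Ω ω : Space ν → ℝ} {ρ : L2 ν}

lemma mem_resolventSet_multiplier_freeSymbol (hΩ : MatterDispersion s Ω)
    (hω : FieldDispersion s ω) (P : Space ν) {z : ℂ}
    (hz : z ∉ Complex.ofReal '' Set.Ici (essentialThreshold Ω ω P)) :
    z ∈ resolventSet (multiplier (freeSymbol Ω ω P)) := by
  have hc := continuous_freeSymbol hΩ hω P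
  by_cases him : z.im = 0
  · have hre : z.re < essentialThreshold Ω ω P := by
      by_contra! h
      exact hz ⟨z.re, h, Complex.ext rfl him.symm⟩
    refine mem_resolventSet_multiplier hc (sub_pos.2 hre) fun k => ?_
    refine le_trans ?_ (Complex.re_le_norm _)
    rw [Complex.sub_re, Complex.ofReal_re]
    exact sub_le_sub_right (essentialThreshold_le hΩ hω P k) _
  · refine mem_resolventSet_multiplier hc (abs_pos.2 him) fun k => ?_
    refine le_trans (le_of_eq ?_) (Complex.abs_im_le_norm _)
    rw [Complex.sub_im, Complex.ofReal_im, zero_sub, abs_neg]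

/-- Outside `[Σ_ess(P), ∞)` the spectrum of `H(P)` is real. -/
lemma exists_lt_of_mem_spectrum (hΩ : MatterDispersion s Ω) (hω : FieldDispersion s ω)
    (P : Space ν) {z : ℂ} (hs : z ∈ spectrum (fiberHamiltonian Ω ω ρ P))
    (hz : z ∉ Complex.ofReal '' Set.Ici (essentialThreshold Ω ω P)) :
    ∃ E : ℝ, E < essentialThreshold Ω ω P ∧ (E : ℂ) = z := by
  obtain ⟨v, hv, hv'⟩ :=
    exists_schur_eq_zero (mem_resolventSet_multiplier_freeSymbol hΩ hω P hz) hs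
  have him := im_eq_zero_of_schur_eq_zero v hv hv'
  have hzre : (z.re : ℂ) = z := Complex.ext rfl him.symm
  exact ⟨z.re, not_le.1 fun h => hz ⟨z.re, h, hzre⟩, hzre⟩

lemma ofReal_notMem_of_lt {E a : ℝ} (h : E < a) : (E : ℂ) ∉ Complex.ofReal '' Set.Ici a := by
  rintro ⟨E', hE', he⟩
  exact (h.trans_le hE').ne' (Complex.ofReal_injective he)

/-- The perturbation binds at most one state below the threshold, because `ℂ` is one-dimensional and
the Schur complement is monotone. -/
lemma subsingleton_spectrum_below (hΩ : MatterDispersion s Ω) (hω : FieldDispersion s ω)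
    (P : Space ν) :
    {E : ℝ | (E : ℂ) ∈ spectrum (fiberHamiltonian Ω ω ρ P) ∧
      E < essentialThreshold Ω ω P}.Subsingleton := by
  rintro E₁ ⟨h₁, hE₁⟩ E₂ ⟨h₂, hE₂⟩
  obtain ⟨v₁, hv₁, hv₁'⟩ := exists_schur_eq_zero
    (mem_resolventSet_multiplier_freeSymbol hΩ hω P (ofReal_notMem_of_lt hE₁)) h₁
  obtain ⟨v₂, hv₂, hv₂'⟩ := exists_schur_eq_zero
    (mem_resolventSet_multiplier_freeSymbol hΩ hω P (ofReal_notMem_of_lt hE₂)) h₂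
  exact eq_of_schur_eq_zero (fun k => hE₁.trans_le (essentialThreshold_le hΩ hω P k))
    (fun k => hE₂.trans_le (essentialThreshold_le hΩ hω P k)) v₁ v₂ hv₁ hv₂ hv₁' hv₂'

lemma Ici_subset_spectrum (hν : 1 ≤ ν) (hΩ : MatterDispersion s Ω) (hω : FieldDispersion s ω)
    (P : Space ν) : Complex.ofReal '' Set.Ici (essentialThreshold Ω ω P) ⊆
      spectrum (fiberHamiltonian Ω ω ρ P) := by
  rw [← range_freeSymbol hν hΩ hω P]
  rintro _ ⟨_, ⟨k, rfl⟩, rfl⟩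
  exact freeSymbol_mem_spectrum hν (continuous_freeSymbol hΩ hω P) ρ k

lemma accPt_ofReal_Ici {a E : ℝ} (h : a ≤ E) :
    AccPt (E : ℂ) (𝓟 (Complex.ofReal '' Set.Ici a)) := by
  have h₁ : AccPt E (𝓟 (Set.Ioi E)) := by
    rw [accPt_principal_iff_nhdsWithin, Set.sdiff_singleton_eq_self Set.self_notMem_Ioi]
    infer_instance
  have h₂ := h₁.map Complex.continuous_ofReal.continuousAt Complex.ofReal_injective
  rw [Filter.map_principal] at h₂
  exact h₂.mono (Filter.principal_mono.2
    (Set.image_mono fun x (hx : E < x) => h.trans hx.le))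

lemma not_accPt_of_lt (hΩ : MatterDispersion s Ω) (hω : FieldDispersion s ω) (P : Space ν)
    {E : ℝ} (hE : E < essentialThreshold Ω ω P)
    (hs : (E : ℂ) ∈ spectrum (fiberHamiltonian Ω ω ρ P)) :
    ¬ AccPt (E : ℂ) (𝓟 (spectrum (fiberHamiltonian Ω ω ρ P))) := by
  rw [accPt_iff_frequently, not_frequently]
  have hcl : IsClosed (Complex.ofReal '' Set.Ici (essentialThreshold Ω ω P)) :=
    Complex.isometry_ofReal.isClosedEmbedding.isClosedMap _ isClosed_Ici
  filter_upwards [hcl.isOpen_compl.mem_nhds (ofReal_notMem_of_lt hE)] with z hz ⟨hne, hzs⟩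
  obtain ⟨E', hE', rfl⟩ := exists_lt_of_mem_spectrum hΩ hω P hzs hz
  exact hne (congrArg _ (subsingleton_spectrum_below hΩ hω P ⟨hzs, hE'⟩ ⟨hs, hE⟩))

end FiberSpectrum

end NelsonFiber

theorem mainTheorem2 {ν : ℕ} (hν : 1 ≤ ν) {s : ℝ}
    {Ω ω : NelsonFiber.Space ν → ℝ} {ρ : NelsonFiber.L2 ν}
    (hΩ : NelsonFiber.MatterDispersion s Ω) (hω : NelsonFiber.FieldDispersion s ω)
    (hρ : NelsonFiber.CouplingFunction ρ) (P : NelsonFiber.Space ν) :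
    (∀ E : ℝ, (E : ℂ) ∈ NelsonFiber.spectrum (NelsonFiber.fiberHamiltonian Ω ω ρ P) →
      E < NelsonFiber.essentialThreshold Ω ω P →
      NelsonFiber.IsFiniteMultiplicityEigenvalue (NelsonFiber.fiberHamiltonian Ω ω ρ P) (E : ℂ)) ∧
    (∀ E : ℝ,
      AccPt E (𝓟 {E' : ℝ | (E' : ℂ) ∈
        NelsonFiber.spectrum (NelsonFiber.fiberHamiltonian Ω ω ρ P) ∧
          E' < NelsonFiber.essentialThreshold Ω ω P}) →
      E = NelsonFiber.essentialThreshold Ω ω P) ∧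
    (∀ E : ℝ, E < NelsonFiber.essentialThreshold Ω ω P →
      {E' : ℝ | (E' : ℂ) ∈ NelsonFiber.spectrum (NelsonFiber.fiberHamiltonian Ω ω ρ P) ∧
        E' ≤ E}.Finite) ∧
    NelsonFiber.essentialSpectrum (NelsonFiber.fiberHamiltonian Ω ω ρ P) =
      Complex.ofReal '' Set.Ici (NelsonFiber.essentialThreshold Ω ω P) := by
  open NelsonFiber in
  have hsub := subsingleton_spectrum_below (ρ := ρ) hΩ hω P
  have heig : ∀ E : ℝ, (E : ℂ) ∈ spectrum (fiberHamiltonian Ω ω ρ P) →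
      E < essentialThreshold Ω ω P →
      IsFiniteMultiplicityEigenvalue (fiberHamiltonian Ω ω ρ P) (E : ℂ) := fun E hs hE =>
    isFiniteMultiplicityEigenvalue_of_mem_spectrum
      (mem_resolventSet_multiplier_freeSymbol hΩ hω P (ofReal_notMem_of_lt hE)) hs
  have hIci := Ici_subset_spectrum (ρ := ρ) hν hΩ hω P
  refine ⟨heig, fun E hacc => ?_, fun E hE => ?_, Set.Subset.antisymm ?_ ?_⟩
  -- a set with at most one element has no accumulation point
  · exact absurd hsub.finite (Set.Infinite.of_accPt hacc)
  · exact hsub.finite.subset fun E' h => ⟨h.1, h.2.trans_lt hE⟩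
  · rintro z ⟨hs, hd⟩
    by_contra hz
    obtain ⟨E, hE, rfl⟩ := exists_lt_of_mem_spectrum hΩ hω P hs hz
    exact hd ⟨hs, not_accPt_of_lt hΩ hω P hE hs, heig E hs hE⟩
  · rintro _ ⟨E, hE, rfl⟩
    refine ⟨hIci ⟨E, hE, rfl⟩, fun hd => hd.2.1 ?_⟩
    exact (accPt_ofReal_Ici hE).mono (Filter.principal_mono.2 hIci)
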